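/- Let $G$ be an abelian group (written additively) and let $X$ be a countably infinite subset of $G$. For $n\in\mathbb N=\{0,1,2,\dots\}$ put $G[n]=\{x\in G: nx=0\}$ (so $G[0]=G$). The Zariski topology $\mathfrak Z_G$ on $G$ is the topology whose closed sets are the arbitrary intersections of finite unions of sets of the form $g+G[n]$ with $g\in G$ and $n\in\mathbb N$. A topological group is called precompact if its completion is compact, and $\mathfrak c$ denotes the cardinality of the continuum. Then the following conditions are equivalent: (i) $X$ is potentially dense in $G$, that is, there is a Hausdorff group topology on $G$ in which $X$ is dense; (ii) there is a precompact Hausdorff group topology on $G$ in which $X$ is dense; (iii) $|G|\le 2^{\mathfrak c}$ and $X$ is Zariski dense in $G$, that is, the closure of $X$ in $(G,\mathfrak Z_G)$ is all of $G$. -/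

import Mathlib

open scoped Cardinal

/-- The subgroup `G[n] = {x ∈ G : n x = 0}`, as a set; in particular `G[0] = G`. -/
def torsionSet (G : Type*) [AddCommGroup G] (n : ℕ) : Set G := {x | n • x = 0}

/-- Elementary algebraic sets: the sets `g + G[n]` with `g ∈ G` and `n ∈ ℕ = {0, 1, 2, …}`. -/
def IsElementaryAlgebraic {G : Type*} [AddCommGroup G] (S : Set G) : Prop :=
  ∃ (g : G) (n : ℕ), S = (fun x => g + x) '' torsionSet G n

/-- Unions of finitely many elementary algebraic sets. -/
def IsFiniteUnionElementaryAlgebraic {G : Type*} [AddCommGroup G] (S : Set G) : Prop :=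
  ∃ A : Set (Set G), A.Finite ∧ (∀ E ∈ A, IsElementaryAlgebraic E) ∧ S = ⋃₀ A

/-- Algebraic sets: arbitrary intersections of finite unions of elementary algebraic sets. -/
def IsAlgebraicSet {G : Type*} [AddCommGroup G] (S : Set G) : Prop :=
  ∃ B : Set (Set G), (∀ F ∈ B, IsFiniteUnionElementaryAlgebraic F) ∧ S = ⋂₀ B

theorem IsFiniteUnionElementaryAlgebraic.union {G : Type*} [AddCommGroup G] {S T : Set G}
    (hS : IsFiniteUnionElementaryAlgebraic S) (hT : IsFiniteUnionElementaryAlgebraic T) :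
    IsFiniteUnionElementaryAlgebraic (S ∪ T) := by
  obtain ⟨A, hA, hA', rfl⟩ := hS
  obtain ⟨B, hB, hB', rfl⟩ := hT
  refine ⟨A ∪ B, hA.union hB, ?_, Set.sUnion_union A B |>.symm⟩
  rintro E (hE | hE)
  · exact hA' E hE
  · exact hB' E hE

theorem isAlgebraicSet_empty {G : Type*} [AddCommGroup G] : IsAlgebraicSet (∅ : Set G) :=
  ⟨{∅}, by rintro F rfl; exact ⟨∅, Set.finite_empty, by simp, by simp⟩, by simp⟩

theorem isAlgebraicSet_sInter {G : Type*} [AddCommGroup G] {A : Set (Set G)}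
    (hA : ∀ S ∈ A, IsAlgebraicSet S) : IsAlgebraicSet (⋂₀ A) := by
  refine ⟨{F | IsFiniteUnionElementaryAlgebraic F ∧ ⋂₀ A ⊆ F}, fun F hF => hF.1, ?_⟩
  apply Set.Subset.antisymm
  · exact Set.subset_sInter fun F hF => hF.2
  · refine Set.subset_sInter fun S hS => ?_
    obtain ⟨B, hB, rfl⟩ := hA S hS
    refine Set.subset_sInter fun F hF => Set.sInter_subset_of_mem ⟨hB F hF, ?_⟩
    exact (Set.sInter_subset_of_mem hS).trans (Set.sInter_subset_of_mem hF)

theorem IsAlgebraicSet.union {G : Type*} [AddCommGroup G] {S T : Set G}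
    (hS : IsAlgebraicSet S) (hT : IsAlgebraicSet T) : IsAlgebraicSet (S ∪ T) := by
  obtain ⟨A, hA, rfl⟩ := hS
  obtain ⟨B, hB, rfl⟩ := hT
  refine ⟨{H | ∃ E ∈ A, ∃ F ∈ B, H = E ∪ F}, ?_, ?_⟩
  · rintro _ ⟨E, hE, F, hF, rfl⟩
    exact (hA E hE).union (hB F hF)
  · ext x
    constructor
    · rintro (hx | hx) _ ⟨E, hE, F, hF, rfl⟩
      · exact Or.inl (hx E hE)
      · exact Or.inr (hx F hF)
    · intro hx
      by_contra h
      simp only [Set.mem_union, Set.mem_sInter, not_or, not_forall] at h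
      obtain ⟨⟨E, hE, hxE⟩, F, hF, hxF⟩ := h
      rcases hx (E ∪ F) ⟨E, hE, F, hF, rfl⟩ with h' | h'
      · exact hxE h'
      · exact hxF h'

/-- The Zariski topology of an abelian group: its closed sets are the algebraic sets. -/
@[reducible]
def zariskiTopology (G : Type*) [AddCommGroup G] : TopologicalSpace G :=
  TopologicalSpace.ofClosed {S : Set G | IsAlgebraicSet S} isAlgebraicSet_empty
    (fun _ hA => isAlgebraicSet_sInter hA) (fun _ hS _ hT => hS.union hT)

/-- The Zariski closure of `X`, i.e. its closure in the Zariski topology. -/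
def zariskiClosure {G : Type*} [AddCommGroup G] (X : Set G) : Set G :=
  @closure G (zariskiTopology G) X

/-- `X` is potentially dense in `G` if it is dense in some Hausdorff group topology on `G`. -/
def PotentiallyDense {G : Type*} [AddCommGroup G] (X : Set G) : Prop :=
  ∃ (_ : TopologicalSpace G), IsTopologicalAddGroup G ∧ T2Space G ∧ Dense X

/-- A topological abelian group is precompact if its completion (with respect to the group
uniformity) is compact. -/
def IsPrecompactGroup (G : Type*) [AddCommGroup G] [TopologicalSpace G]
    [IsTopologicalAddGroup G] : Prop :=
  letI : UniformSpace G := IsTopologicalAddGroup.rightUniformSpace G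
  CompactSpace (UniformSpace.Completion G)

/-! ### Extension and perturbation of characters with values in the circle. -/

section Characters

/-! Algebraic sets are closed in every Hausdorff group topology, and a separable Hausdorff space has
at most `2 ^ 𝔠` points, so potential density gives the third condition. The work lies in building a
precompact topology, i.e. an injective homomorphism `π` from `G` to the power of the circle over the
Cantor space, with `X` dense for the induced topology.

Let `m` be the number such that `G[d]` has finite index iff `m ∣ d`. By Neumann's lemma on coverings
by cosets, Zariski density makes the trace of `X` on each coset of `G[m]` spread
(`isSpread_of_zariskiClosure_eq_univ`). At some point of a spread set, any value killed by `m` can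
be approximated after a small change of a character (`IsSpread.exists_perturbation`). Baire category
turns this into one continuous family `φ` of characters of a countable group `E` meeting all such
requirements (`exists_generic_family`).

Here `G` maps to `E`, injectively on a subgroup `D` containing `X`. Generic characters of `E` cannot
separate all of `G`, so coordinate `z` of `π` is `φ` at `z` plus a character `σ (κ z)` from a
separating family of size `𝔠`; this is where `#G ≤ 2 ^ 𝔠` enters. On `D` the shifts have only
countably many restrictions, and `φ` is generic relative to all of them, so density survives. -/

/-- A homomorphism into a divisible group that kills the kernel of `f` factors through the
codomain of `f`. -/
theorem exists_comp_eq_of_ker_le {A B Q : Type*} [AddCommGroup A] [AddCommGroup B]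
    [AddCommGroup Q] [DivisibleBy Q ℤ] (f : A →+ B) (g : A →+ Q) (h : f.ker ≤ g.ker) :
    ∃ χ : B →+ Q, ∀ a, χ (f a) = g a := by
  obtain ⟨χ, hχ⟩ := (Module.Baer.of_divisible Q).extension_property_addMonoidHom
    (QuotientAddGroup.kerLift f) (QuotientAddGroup.kerLift_injective f)
    (QuotientAddGroup.lift f.ker g h)
  exact ⟨χ, fun a => DFunLike.congr_fun hχ (QuotientAddGroup.mk a)⟩

/-- A homomorphism on `H` extends with the value `v` at `y` as soon as `v` is compatible with
the order of `y` modulo `H`. -/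
theorem exists_extension_apply_eq {E Q : Type*} [AddCommGroup E] [AddCommGroup Q]
    [DivisibleBy Q ℤ] (H : AddSubgroup E) (χ : H →+ Q) (y : E) (v : Q) (z : H)
    (hz : (z : E) = addOrderOf (y : E ⧸ H) • y) (hv : addOrderOf (y : E ⧸ H) • v = χ z) :
    ∃ χ' : E →+ Q, (∀ h : H, χ' h = χ h) ∧ χ' y = v := by
  set o := addOrderOf (y : E ⧸ H)
  -- Extend along `H × ℤ → E`, `(h, k) ↦ h + k • y`; its kernel is generated by the relation `z = o
  -- • y`.
  obtain ⟨χ', hχ'⟩ := exists_comp_eq_of_ker_le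
    (H.subtype.coprod (zmultiplesHom E y)) (χ.coprod (zmultiplesHom Q v)) (by
      rintro ⟨h, k⟩ hk
      simp only [AddMonoidHom.mem_ker, AddMonoidHom.coprod_apply, AddSubgroup.subtype_apply,
        zmultiplesHom_apply] at hk ⊢
      have hky : k • (y : E ⧸ H) = 0 := by
        rw [← QuotientAddGroup.mk_zsmul, QuotientAddGroup.eq_zero_iff]
        rw [← eq_neg_iff_add_eq_zero] at hk
        rw [show k • y = -(h : E) by rw [hk, neg_neg]]
        exact H.neg_mem h.2
      obtain ⟨j, rfl⟩ := addOrderOf_dvd_iff_zsmul_eq_zero.2 hky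
      have hh : h = -(j • z) := by
        apply Subtype.ext
        rw [AddSubgroup.coe_neg, AddSubgroup.coe_zsmul, hz, eq_neg_iff_add_eq_zero, ← hk,
          mul_comm, mul_zsmul, natCast_zsmul]
      rw [hh, map_neg, map_zsmul, ← hv, mul_comm, mul_zsmul, natCast_zsmul, neg_add_cancel])
  refine ⟨χ', fun h => ?_, ?_⟩
  · simpa using hχ' (h, 0)
  · simpa using hχ' (0, 1)

/-- An infinite subset of a finitely generated abelian group is unbounded in some integral
coordinate. -/
theorem exists_hom_int_unbounded {H : Type*} [AddCommGroup H] [AddGroup.FG H] {S : Set H}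
    (hS : S.Infinite) : ∃ c : H →+ ℤ, ∀ B : ℕ, ∃ s ∈ S, B ≤ (c s).natAbs := by
  obtain ⟨n, ι, hι, p, hp, e, ⟨f⟩⟩ := AddCommGroup.equiv_free_prod_directSum_zmod H
  by_contra! hc
  have : ∀ i, NeZero (p i ^ e i) := fun i => ⟨pow_ne_zero _ (hp i).ne_zero⟩
  have : Finite (DirectSum ι fun i => ZMod (p i ^ e i)) :=
    Finite.of_equiv (∀ i, ZMod (p i ^ e i)) DFinsupp.equivFunOnFintype.symm
  have hb (i : Fin n) : ∃ B : ℕ, ∀ s ∈ S, ((f s).1 i).natAbs < B :=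
    hc ((Finsupp.applyAddHom i).comp ((AddMonoidHom.fst _ _).comp f.toAddMonoidHom))
  choose B hB using hb
  -- With all integral coordinates bounded, `S` embeds in a box times the finite torsion part.
  have hfin : ((fun s => ((fun i => (f s).1 i : Fin n → ℤ), (f s).2)) '' S).Finite := by
    refine ((Set.Finite.pi' fun i => Set.finite_Icc (-(B i : ℤ)) (B i)).prod
      Set.finite_univ).subset ?_
    rintro _ ⟨s, hs, rfl⟩
    refine ⟨fun i => ?_, trivial⟩
    have := hB i s hs
    simp only [Set.mem_Icc]
    omega
  refine hS (hfin.of_finite_image ?_)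
  intro s _ t _ hst
  simp only [Prod.mk.injEq] at hst
  exact f.injective (Prod.ext (DFunLike.coe_injective hst.1) hst.2)

/-- Every element of the circle is represented by a real number in `[0, 1)`. -/
theorem UnitAddCircle.exists_coe_eq (w : UnitAddCircle) :
    ∃ a : ℝ, 0 ≤ a ∧ a < 1 ∧ (a : UnitAddCircle) = w := by
  obtain ⟨a, ha, rfl⟩ := (AddCircle.coe_image_Ico_eq (p := (1 : ℝ)) 0).symm ▸ Set.mem_univ w
  exact ⟨a, ha.1, by simpa using ha.2, rfl⟩

theorem UnitAddCircle.norm_coe_le (a : ℝ) : ‖(a : UnitAddCircle)‖ ≤ |a| :=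
  (QuotientAddGroup.norm_mk_le_norm (S := AddSubgroup.zmultiples (1 : ℝ)) (m := a))

/-- Among the `o`-th roots of `w` there is one at distance at most `1 / o` from `u`. -/
theorem UnitAddCircle.exists_nsmul_eq_dist_le {o : ℕ} (ho : o ≠ 0) (w u : UnitAddCircle) :
    ∃ v : UnitAddCircle, o • v = w ∧ dist v u ≤ 1 / o := by
  obtain ⟨a, ha0, ha1, ha⟩ := UnitAddCircle.exists_coe_eq (w - o • u)
  have ho' : (0 : ℝ) < o := by positivity
  refine ⟨u + ((a / o : ℝ) : UnitAddCircle), ?_, ?_⟩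
  · rw [smul_add, ← AddCircle.coe_nsmul, nsmul_eq_mul, mul_div_cancel₀ _ ho'.ne', ha]
    abel
  · rw [dist_eq_norm, add_sub_cancel_left]
    refine (UnitAddCircle.norm_coe_le _).trans ?_
    rw [abs_of_nonneg (by positivity)]
    gcongr

/-- `Y` is not covered by finitely many fibres of multiplications by numbers that are not
divisible by `m`. -/
def IsSpread {A : Type*} [AddCommGroup A] (m : ℕ) (Y : Set A) : Prop :=
  ∀ T : Set (ℕ × A), T.Finite → (∀ t ∈ T, ¬ m ∣ t.1) → ∃ y ∈ Y, ∀ t ∈ T, t.1 • y ≠ t.2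

/-- Each attained value in the target is the image of a multiple of some point of `Y`, so
injectivity on `D` pulls a finite cover back; unattained values may be replaced by `0`. -/
theorem IsSpread.image {A B : Type*} [AddCommGroup A] [AddCommGroup B] {m : ℕ} {Y : Set A}
    (hY : IsSpread m Y) (f : A →+ B) (D : AddSubgroup A) (hYD : Y ⊆ D)
    (hf : Set.InjOn f D) : IsSpread m (f '' Y) := by
  classical
  intro T hT hTm
  let r : ℕ × B → ℕ × A := fun t =>
    (t.1, if h : ∃ y ∈ Y, t.1 • f y = t.2 then t.1 • h.choose else 0)
  obtain ⟨y, hy, hyT⟩ := hY (r '' T) (hT.image r) (by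
    rintro _ ⟨t, ht, rfl⟩
    exact hTm t ht)
  refine ⟨f y, ⟨y, hy, rfl⟩, fun t ht hty => hyT (r t) ⟨t, ht, rfl⟩ ?_⟩
  have h : ∃ y ∈ Y, t.1 • f y = t.2 := ⟨y, hy, hty⟩
  simp only [r, dif_pos h]
  refine hf (D.nsmul_mem (hYD hy) _) (D.nsmul_mem (hYD h.choose_spec.1) _) ?_
  rw [map_nsmul, map_nsmul, hty, h.choose_spec.2]

/-- A spread set of elements killed by `m` contains a point at which every character can be given
approximately any prescribed value killed by `m`, changing it little on a given finite set. -/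
theorem IsSpread.exists_perturbation {E : Type*} [AddCommGroup E] {m : ℕ} {Y : Set E}
    (hY : IsSpread m Y) (hm : ∀ y ∈ Y, m • y = 0) (F : Finset E) {ε : ℝ} (hε : 0 < ε) :
    ∃ y ∈ Y, ∀ (χ : E →+ UnitAddCircle) (u : UnitAddCircle), m • u = 0 →
      ∃ χ' : E →+ UnitAddCircle, (∀ x ∈ F, dist (χ' x) (χ x) < ε) ∧ dist (χ' y) u < ε := by
  set H : AddSubgroup E := AddSubgroup.closure (F : Set E) with hH
  have hFH : ∀ x ∈ F, x ∈ H := fun x hx => AddSubgroup.subset_closure hx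
  have : AddGroup.FG H := (AddGroup.fg_iff_addSubgroup_fg _).2 ⟨F, rfl⟩
  set o : E → ℕ := fun y => addOrderOf (y : E ⧸ H) with ho
  have hoH (y : E) : o y • y ∈ H := by
    rw [← QuotientAddGroup.eq_zero_iff, QuotientAddGroup.mk_nsmul]
    exact addOrderOf_nsmul_eq_zero _
  obtain ⟨M, hM⟩ := exists_nat_gt (1 / ε)
  -- Here `o y • y = 0`, and every `u` killed by `m` is an admissible value. Infinite order modulo
  -- `H` is included, since then `o y = 0`.
  by_cases h1 : ∃ y ∈ Y, m ∣ o y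
  · obtain ⟨y, hy, k, hk⟩ := h1
    refine ⟨y, hy, fun χ u hu => ?_⟩
    have h0 : o y • y = 0 := by rw [hk, mul_comm, mul_nsmul', hm y hy, smul_zero]
    obtain ⟨χ', h, h'⟩ := exists_extension_apply_eq H (χ.comp H.subtype) y u 0
      (by simpa using h0.symm)
      (by
        change o y • u = _
        rw [hk, mul_comm, mul_nsmul', hu, smul_zero, map_zero])
    refine ⟨χ', fun x hx => ?_, by rwa [h', dist_self]⟩
    rw [h ⟨x, hFH x hx⟩]
    simpa using hε
  -- For large order the admissible values at `y` form a `1 / o y`-net, so `χ` need not change on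
  -- `H`.
  by_cases h2 : ∃ y ∈ Y, M ≤ o y
  · obtain ⟨y, hy, hMy⟩ := h2
    have hM0 : (0 : ℝ) < M := lt_trans (by positivity) hM
    have hoM : (M : ℝ) ≤ o y := by exact_mod_cast hMy
    refine ⟨y, hy, fun χ u _ => ?_⟩
    obtain ⟨v, hv, hvu⟩ := UnitAddCircle.exists_nsmul_eq_dist_le (o := o y)
      (by have : (0 : ℝ) < o y := hM0.trans_le hoM
          exact_mod_cast this.ne') (χ (o y • y)) u
    obtain ⟨χ', h, h'⟩ := exists_extension_apply_eq H (χ.comp H.subtype) y v ⟨_, hoH y⟩ rfl hv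
    refine ⟨χ', fun x hx => ?_, ?_⟩
    · rw [h ⟨x, hFH x hx⟩]
      simpa using hε
    · rw [h']
      refine hvu.trans_lt ((one_div_le_one_div_of_le hM0 hoM).trans_lt ?_)
      rwa [one_div_lt hM0 hε]
  push Not at h1 h2
  -- The orders are now below `M` and not divisible by `m`. If each gave only finitely many values
  -- `d • y`, the pairs `(d, d • y)` would contradict spreadness.
  obtain ⟨d, hd⟩ : ∃ d, {h : H | ∃ y ∈ Y, o y = d ∧ d • y = h}.Infinite := by
    by_contra! hfin
    obtain ⟨y, hy, hyT⟩ := hY (⋃ d ∈ {d | d < M ∧ ¬ m ∣ d},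
      (fun h : H => (d, (h : E))) '' {h : H | ∃ y ∈ Y, o y = d ∧ d • y = h})
      (((Set.finite_lt_nat M).subset fun d hd => hd.1).biUnion fun d _ =>
        (hfin d).image _)
      (by
        rintro t ht
        simp only [Set.mem_iUnion] at ht
        obtain ⟨d, hd, h, -, rfl⟩ := ht
        exact hd.2)
    refine hyT (o y, o y • y) ?_ rfl
    simp only [Set.mem_iUnion]
    exact ⟨o y, ⟨h2 y hy, h1 y hy⟩, ⟨_, hoH y⟩, ⟨y, hy, rfl, rfl⟩, rfl⟩
  obtain ⟨c, hc⟩ := exists_hom_int_unbounded hd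
  obtain ⟨C, hC⟩ : ∃ C : ℕ, ∀ x (hx : x ∈ F), (c ⟨x, hFH x hx⟩).natAbs ≤ C :=
    ⟨F.attach.sup fun x => (c ⟨x, hFH x x.2⟩).natAbs, fun x hx =>
      Finset.le_sup (f := fun x : F => (c ⟨x, hFH x x.2⟩).natAbs) (Finset.mem_attach F ⟨x, hx⟩)⟩
  obtain ⟨B, hB⟩ := exists_nat_gt (C / ε)
  have hB0 : (0 : ℝ) < B := lt_of_le_of_lt (by positivity) hB
  obtain ⟨s, ⟨y, hy, hoy, hys⟩, hs⟩ := hc B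
  have hsB : (B : ℝ) ≤ |(c s : ℝ)| := by
    rw [← Int.cast_abs, ← Int.natCast_natAbs]
    exact_mod_cast hs
  have hs0 : (c s : ℝ) ≠ 0 := abs_pos.1 (hB0.trans_le hsB)
  refine ⟨y, hy, fun χ u _ => ?_⟩
  obtain ⟨a, ha0, ha1, ha⟩ := UnitAddCircle.exists_coe_eq (d • u - χ s)
  -- The correction `g ∘ c` equals the defect `d • u - χ s` at `s`, yet has norm at most `C / B < ε`
  -- on `F`, because `c s` is huge.
  let g : ℤ →+ UnitAddCircle := zmultiplesHom _ ((a / c s : ℝ) : UnitAddCircle)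
  have hg (k : ℤ) : g k = ((k * (a / c s) : ℝ) : UnitAddCircle) := by
    rw [← zsmul_eq_mul, AddCircle.coe_zsmul]
    rfl
  obtain ⟨χ', h, h'⟩ := exists_extension_apply_eq H (χ.comp H.subtype + g.comp c) y u s
    (by rw [← hys, ← hoy]) (by
      change o y • u = χ s + g (c s)
      rw [hoy, hg, mul_div_cancel₀ _ hs0, ha]
      abel)
  refine ⟨χ', fun x hx => ?_, by rwa [h', dist_self]⟩
  rw [h ⟨x, hFH x hx⟩, dist_eq_norm]
  change ‖χ x + g (c ⟨x, hFH x hx⟩) - χ x‖ < ε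
  rw [add_sub_cancel_left, hg]
  refine (UnitAddCircle.norm_coe_le _).trans_lt ?_
  have hCx : |(c ⟨x, hFH x hx⟩ : ℝ)| ≤ C := by
    rw [← Int.cast_abs, ← Int.natCast_natAbs]
    exact_mod_cast hC x hx
  rw [abs_mul, abs_div, abs_of_nonneg ha0]
  calc |(c ⟨x, hFH x hx⟩ : ℝ)| * (a / |(c s : ℝ)|) ≤ C * (1 / B) := by gcongr
    _ = C / B := by ring
    _ < ε := by rwa [div_lt_comm₀ hB0 hε]

end Characters

/-! ### Torsion subgroups of finite index and Zariski density. -/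

section Zariski

open scoped Pointwise Topology

variable {G : Type*} [AddCommGroup G]

/-- The torsion subgroup `G[n]` as the kernel of multiplication by `n`. -/
def torsionKer (G : Type*) [AddCommGroup G] (n : ℕ) : AddSubgroup G :=
  (nsmulAddMonoidHom n : G →+ G).ker

theorem mem_torsionKer {n : ℕ} {x : G} : x ∈ torsionKer G n ↔ n • x = 0 := Iff.rfl

theorem torsionKer_mono {m n : ℕ} (h : m ∣ n) : torsionKer G m ≤ torsionKer G n := by
  obtain ⟨k, rfl⟩ := h
  intro x hx
  rw [mem_torsionKer] at hx ⊢
  rw [mul_comm, mul_nsmul', hx, smul_zero]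

theorem torsionKer_inf_le (m n : ℕ) :
    torsionKer G m ⊓ torsionKer G n ≤ torsionKer G (m.gcd n) := by
  rintro x ⟨hm, hn⟩
  exact addOrderOf_dvd_iff_nsmul_eq_zero.1 (Nat.dvd_gcd
    (addOrderOf_dvd_iff_nsmul_eq_zero.2 hm) (addOrderOf_dvd_iff_nsmul_eq_zero.2 hn))

/-- The numbers `d` for which `G[d]` has finite index are the multiples of a single number. -/
theorem exists_finiteIndex_torsionKer_iff (G : Type*) [AddCommGroup G] :
    ∃ m : ℕ, ∀ d, (torsionKer G d).FiniteIndex ↔ m ∣ d := by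
  classical
  have h0 : torsionKer G 0 = ⊤ := by
    ext x
    simp [mem_torsionKer]
  by_cases h : ∃ n, 0 < n ∧ (torsionKer G n).FiniteIndex
  · refine ⟨Nat.find h, fun d => ⟨fun hd => ?_, fun hd => ?_⟩⟩
    · obtain ⟨hpos, hfin⟩ := Nat.find_spec h
      have hle : Nat.find h ≤ d.gcd (Nat.find h) :=
        Nat.find_min' h ⟨Nat.gcd_pos_of_pos_right _ hpos,
          AddSubgroup.finiteIndex_of_le (torsionKer_inf_le d (Nat.find h))⟩
      rw [Nat.le_antisymm hle (Nat.le_of_dvd hpos (Nat.gcd_dvd_right d _))]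
      exact Nat.gcd_dvd_left d _
    · have := (Nat.find_spec h).2
      exact AddSubgroup.finiteIndex_of_le (torsionKer_mono hd)
  · refine ⟨0, fun d => ?_⟩
    rw [zero_dvd_iff]
    constructor
    · intro hd
      by_contra hd0
      exact h ⟨d, Nat.pos_of_ne_zero hd0, hd⟩
    · rintro rfl
      rw [h0]
      infer_instance

theorem isClosed_zariskiTopology_iff {S : Set G} :
    IsClosed[zariskiTopology G] S ↔ IsAlgebraicSet S := by
  rw [← @isOpen_compl_iff _ _ (zariskiTopology G)]
  change IsAlgebraicSet Sᶜᶜ ↔ _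
  rw [compl_compl]

theorem zariskiClosure_subset {X S : Set G} (hS : IsAlgebraicSet S) (h : X ⊆ S) :
    zariskiClosure X ⊆ S := by
  let := zariskiTopology G
  exact closure_minimal h (isClosed_zariskiTopology_iff.2 hS)

/-- A finite union of cosets of torsion subgroups is algebraic. -/
theorem isAlgebraicSet_biUnion (C : Finset (G × ℕ)) :
    IsAlgebraicSet (⋃ c ∈ C, c.1 +ᵥ (torsionKer G c.2 : Set G)) := by
  refine ⟨{⋃ c ∈ C, c.1 +ᵥ (torsionKer G c.2 : Set G)}, ?_, by simp⟩
  rintro _ rfl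
  refine ⟨(fun c : G × ℕ => c.1 +ᵥ (torsionKer G c.2 : Set G)) '' C,
    C.finite_toSet.image _, ?_, by simp⟩
  rintro _ ⟨c, -, rfl⟩
  exact ⟨c.1, c.2, rfl⟩

/-- The trace of a Zariski dense set on a coset of the component `G[m]` is spread. -/
theorem isSpread_of_zariskiClosure_eq_univ {X : Set G} (hX : zariskiClosure X = Set.univ) {m : ℕ}
    (hm : ∀ d, (torsionKer G d).FiniteIndex ↔ m ∣ d) (g : G) :
    IsSpread m {y | m • y = 0 ∧ g + y ∈ X} := by
  classical
  intro T hT hTm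
  by_contra! hcov
  have : (torsionKer G m).FiniteIndex := (hm m).2 dvd_rfl
  have : Fintype (G ⧸ torsionKer G m) := Fintype.ofFinite _
  let r : ℕ × G → G × ℕ := fun t =>
    (g + if h : ∃ x : G, t.1 • x = t.2 then h.choose else 0, t.1)
  -- `C₁` covers everything outside `g + G[m]`; the supposed cover by `T` handles the rest of `X`.
  let C₁ : Finset (G × ℕ) := (Finset.univ.filter fun q : G ⧸ torsionKer G m => q ≠ g).image
    fun q => (q.out, m)
  let C : Finset (G × ℕ) := C₁ ∪ hT.toFinset.image r
  have hXC : X ⊆ ⋃ c ∈ C, c.1 +ᵥ (torsionKer G c.2 : Set G) := by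
    intro x hx
    simp only [Set.mem_iUnion, Set.mem_vadd_set_iff_neg_vadd_mem, SetLike.mem_coe, vadd_eq_add,
      mem_torsionKer]
    by_cases hxg : (x : G ⧸ torsionKer G m) = g
    · have hy : m • (x - g) = 0 := by
        rw [QuotientAddGroup.eq, mem_torsionKer] at hxg
        rw [← neg_eq_zero, ← smul_neg, neg_sub, sub_eq_neg_add, hxg]
      obtain ⟨t, ht, hty⟩ := hcov (x - g) ⟨hy, by simpa using hx⟩
      have hex : ∃ x : G, t.1 • x = t.2 := ⟨_, hty⟩
      refine ⟨r t, Finset.mem_union_right _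
        (Finset.mem_image_of_mem _ (hT.mem_toFinset.2 ht)), ?_⟩
      simp only [r, dif_pos hex]
      rw [show -(g + hex.choose) + x = (x - g) - hex.choose by abel, smul_sub, hty,
        hex.choose_spec, sub_self]
    · refine ⟨((x : G ⧸ torsionKer G m).out, m), Finset.mem_union_left _
        (Finset.mem_image.2 ⟨x, by simpa using hxg, rfl⟩), ?_⟩
      rw [← mem_torsionKer, ← QuotientAddGroup.eq]
      exact Quotient.out_eq _
  have huniv : ⋃ c ∈ C, c.1 +ᵥ (torsionKer G c.2 : Set G) = Set.univ :=
    Set.univ_subset_iff.1 (hX ▸ zariskiClosure_subset (isAlgebraicSet_biUnion C) hXC)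
  -- Neumann's lemma discards the cosets of infinite index, in particular all those coming from `T`;
  -- what remains misses `g`.
  have hg := (AddSubgroup.leftCoset_cover_filter_FiniteIndex huniv).symm ▸ Set.mem_univ g
  simp only [Set.mem_iUnion, Finset.mem_filter, hm] at hg
  obtain ⟨c, ⟨hc, hmc⟩, hgc⟩ := hg
  rcases Finset.mem_union.1 hc with hc | hc
  · obtain ⟨q, hq, rfl⟩ := Finset.mem_image.1 hc
    refine (Finset.mem_filter.1 hq).2 ?_
    rw [Set.mem_vadd_set_iff_neg_vadd_mem, vadd_eq_add, SetLike.mem_coe,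
      ← QuotientAddGroup.eq] at hgc
    exact (Quotient.out_eq q).symm.trans hgc
  · obtain ⟨t, ht, rfl⟩ := Finset.mem_image.1 hc
    exact hTm t (hT.mem_toFinset.1 ht) hmc

end Zariski

/-! ### Generic continuous families of characters over the Cantor space. -/

section Generic

/-- The first `n` coordinates of a point of the Cantor space. -/
def cantorRestrict (n : ℕ) : C(ℕ → Bool, Fin n → Bool) where
  toFun z i := z i
  continuous_toFun := by fun_prop

/-- A continuous function on the Cantor space varies little on cylinders of large length. -/
theorem exists_forall_cantorRestrict_eq_dist_lt (f : C(ℕ → Bool, UnitAddCircle)) {δ : ℝ}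
    (hδ : 0 < δ) :
    ∃ N, ∀ z z', cantorRestrict N z = cantorRestrict N z' → dist (f z) (f z') < δ := by
  let : MetricSpace (ℕ → Bool) := PiNat.metricSpaceOfDiscreteUniformity (E := fun _ => Bool) fun _ => rfl
  obtain ⟨η, hη, h⟩ := Metric.uniformContinuous_iff.1
    (CompactSpace.uniformContinuous_of_continuous f.continuous) δ hδ
  obtain ⟨N, hN⟩ := exists_pow_lt_of_lt_one hη (by norm_num : (1 / 2 : ℝ) < 1)
  refine ⟨N, fun z z' hz => h (lt_of_le_of_lt ?_ hN)⟩
  rw [← PiNat.mem_cylinder_iff_dist_le, PiNat.mem_cylinder_iff]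
  exact fun i hi => congrFun hz ⟨i, hi⟩

theorem exists_forall_finset_cantorRestrict_eq_dist_lt (F : Finset C(ℕ → Bool, UnitAddCircle))
    (n : ℕ) {δ : ℝ} (hδ : 0 < δ) :
    ∃ N, n ≤ N ∧ ∀ f ∈ F, ∀ z z', cantorRestrict N z = cantorRestrict N z' →
      dist (f z) (f z') < δ := by
  choose N hN using fun f => exists_forall_cantorRestrict_eq_dist_lt f hδ
  refine ⟨n ⊔ F.sup N, le_sup_left, fun f hf z z' h => hN f z z' ?_⟩
  funext i
  exact congrFun h ⟨i, i.2.trans_le ((Finset.le_sup hf).trans le_sup_right)⟩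

variable {E : Type*} [AddCommGroup E] {K : Type*}

/-- A continuous family of characters can be perturbed slightly so that its values at a suitable
point of a spread set, shifted by given characters, approximate prescribed values. -/
theorem IsSpread.exists_perturbation_family {m : ℕ} {Y : Set E} (hY : IsSpread m Y)
    (hm : ∀ y ∈ Y, m • y = 0) (ρ : K → E →+ UnitAddCircle)
    (φ : E →+ C(ℕ → Bool, UnitAddCircle)) (F : Finset E) {δ : ℝ} (hδ : 0 < δ) (n : ℕ)
    (k : (Fin n → Bool) → K) (u : (Fin n → Bool) → UnitAddCircle) (hu : ∀ w, m • u w = 0) :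
    ∃ φ' : E →+ C(ℕ → Bool, UnitAddCircle), (∀ x ∈ F, dist (φ' x) (φ x) < δ) ∧
      ∃ y ∈ Y, ∀ z, dist (φ' y z + ρ (k (cantorRestrict n z)) y) (u (cantorRestrict n z)) < δ := by
  classical
  obtain ⟨y, hy, hpert⟩ := hY.exists_perturbation hm F (half_pos hδ)
  obtain ⟨N, hnN, hN⟩ :=
    exists_forall_finset_cantorRestrict_eq_dist_lt (F.image φ) n (half_pos hδ)
  -- One sample point per cylinder of length `N`: the new family is constant on these cylinders,
  -- hence continuous.
  let e : (Fin N → Bool) → ℕ → Bool := fun w i => if h : i < N then w ⟨i, h⟩ else false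
  have he (z : ℕ → Bool) : cantorRestrict N (e (cantorRestrict N z)) = cantorRestrict N z := by
    funext i
    simp [e, cantorRestrict]
  have he' (z : ℕ → Bool) : cantorRestrict n (e (cantorRestrict N z)) = cantorRestrict n z := by
    funext i
    exact congrFun (he z) ⟨i, i.2.trans_le hnN⟩
  have hex (w : Fin N → Bool) := hpert
    (AddMonoidHom.mk' (fun x => φ x (e w)) (fun x x' => by simp))
    (u (cantorRestrict n (e w)) - ρ (k (cantorRestrict n (e w))) y) (by
      rw [smul_sub, hu, ← map_nsmul, hm y hy, map_zero, sub_zero])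
  choose χ hχF hχy using hex
  refine ⟨AddMonoidHom.mk' (fun x => ContinuousMap.comp
      ⟨fun w => χ w x, continuous_of_discreteTopology⟩ (cantorRestrict N)) (fun x x' => by
        ext z
        simp), fun x hx => ?_, y, hy, fun z => ?_⟩
  · rw [ContinuousMap.dist_lt_iff hδ]
    intro z
    calc dist (χ (cantorRestrict N z) x) (φ x z)
        ≤ dist (χ (cantorRestrict N z) x) (φ x (e (cantorRestrict N z)))
          + dist (φ x (e (cantorRestrict N z))) (φ x z) := dist_triangle _ _ _
      _ < δ / 2 + δ / 2 := add_lt_add (hχF _ x hx)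
          (hN _ (Finset.mem_image_of_mem _ hx) _ _ (he z))
      _ = δ := add_halves δ
  · have h := hχy (cantorRestrict N z)
    rw [he', dist_eq_norm, ← sub_add] at h
    change dist (χ (cantorRestrict N z) y + _) _ < δ
    rw [dist_eq_norm, add_sub_right_comm]
    exact h.trans (half_lt_self hδ)

/-- There is a continuous family of characters, indexed by the Cantor space, whose shifts by given
countably many characters have independently prescribed approximate values on given countably many
spread sets. -/
theorem exists_generic_family [Countable E] [Countable K] {ι : Type*} [Countable ι] {m : ℕ}
    (Y : ι → Set E) (hY : ∀ s, IsSpread m (Y s)) (hm : ∀ s, ∀ y ∈ Y s, m • y = 0)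
    (ρ : K → E →+ UnitAddCircle) :
    ∃ φ : E →+ C(ℕ → Bool, UnitAddCircle), ∀ s n (k : (Fin n → Bool) → K)
      (u : (Fin n → Bool) → UnitAddCircle), (∀ w, m • u w = 0) → ∀ ε > 0, ∃ y ∈ Y s, ∀ z,
        dist (φ y z + ρ (k (cantorRestrict n z)) y) (u (cantorRestrict n z)) < ε := by
  classical
  let A : Set (E → C(ℕ → Bool, UnitAddCircle)) := {φ | ∀ x x', φ (x + x') = φ x + φ x'}
  have hA : IsClosed A := by
    simp only [A, Set.ofPred_forall]
    exact isClosed_iInter fun x => isClosed_iInter fun x' =>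
      isClosed_eq (by fun_prop) (by fun_prop)
  have : CompleteSpace A := hA.completeSpace_coe
  let R := {t : UnitAddCircle // m • t = 0}
  have : Nonempty R := ⟨0, smul_zero _⟩
  -- Targets range over a dense sequence and tolerances over `1 / (j + 1)`, which keeps the index
  -- set countable for Baire.
  let I := Σ (_ : ι) (n : ℕ), ((Fin n → Bool) → K) × ((Fin n → Bool) → ℕ) × ℕ
  let target (n : ℕ) (v : (Fin n → Bool) → ℕ) (w : Fin n → Bool) : UnitAddCircle :=
    (TopologicalSpace.denseSeq R (v w)).1
  let V : I → Set A := fun i => {φ | ∃ y ∈ Y i.1, ∀ z,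
    dist (φ.1 y z + ρ (i.2.2.1 (cantorRestrict i.2.1 z)) y)
      (target i.2.1 i.2.2.2.1 (cantorRestrict i.2.1 z)) < 1 / ((i.2.2.2.2 : ℝ) + 1)}
  have hVo (i : I) : IsOpen (V i) := by
    have : V i = ⋃ y ∈ Y i.1, {φ : A | dist
        (φ.1 y + ContinuousMap.comp ⟨fun w => ρ (i.2.2.1 w) y, continuous_of_discreteTopology⟩
          (cantorRestrict i.2.1))
        (ContinuousMap.comp ⟨target i.2.1 i.2.2.2.1, continuous_of_discreteTopology⟩
          (cantorRestrict i.2.1)) < 1 / ((i.2.2.2.2 : ℝ) + 1)} := by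
      ext φ
      simp only [V, Set.mem_ofPred_eq, Set.mem_iUnion, exists_prop,
        ContinuousMap.dist_lt_iff (Nat.one_div_pos_of_nat (α := ℝ))]
      rfl
    rw [this]
    exact isOpen_biUnion fun y _ => isOpen_lt
      ((((continuous_apply y).comp continuous_subtype_val).add continuous_const).dist
        continuous_const) continuous_const
  have hVd (i : I) : Dense (V i) := by
    rw [dense_iff_inter_open]
    rintro U hU ⟨φ, hφ⟩
    obtain ⟨W, hW, rfl⟩ := isOpen_induced_iff.1 hU
    obtain ⟨F, B, hB, hBW⟩ := isOpen_pi_iff.1 hW φ.1 hφ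
    have hev : ∀ᶠ δ in nhdsWithin (0 : ℝ) (Set.Ioi 0),
        ∀ a ∈ F, Metric.ball (φ.1 a) δ ⊆ B a := by
      rw [Filter.eventually_all_finset]
      intro a ha
      obtain ⟨δ, hδ, h⟩ := Metric.isOpen_iff.1 (hB a ha).1 _ (hB a ha).2
      filter_upwards [Ioo_mem_nhdsGT hδ] with δ' hδ'
      exact (Metric.ball_subset_ball hδ'.2.le).trans h
    obtain ⟨δ, hδF, hδ⟩ := (hev.and (Ioo_mem_nhdsGT
      (Nat.one_div_pos_of_nat (α := ℝ) (n := i.2.2.2.2)))).exists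
    obtain ⟨φ', hφF, y, hy, hφy⟩ := (hY i.1).exists_perturbation_family (hm i.1) ρ
      (AddMonoidHom.mk' φ.1 φ.2) F hδ.1 i.2.1 i.2.2.1 (target i.2.1 i.2.2.2.1)
      (fun w => (TopologicalSpace.denseSeq R _).2)
    exact ⟨⟨φ', map_add φ'⟩, hBW fun a ha => hδF a ha (hφF a ha),
      y, hy, fun z => (hφy z).trans hδ.2⟩
  have : Nonempty A := ⟨⟨0, fun _ _ => by simp⟩⟩
  obtain ⟨φ, hφ⟩ := (dense_iInter_of_isOpen hVo hVd).nonempty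
  rw [Set.mem_iInter] at hφ
  refine ⟨AddMonoidHom.mk' φ.1 φ.2, fun s n k u hu ε hε => ?_⟩
  obtain ⟨j, hj⟩ := exists_nat_one_div_lt (half_pos hε)
  have hv (w : Fin n → Bool) :
      ∃ l, dist (⟨u w, hu w⟩ : R) (TopologicalSpace.denseSeq R l) < ε / 2 := by
    obtain ⟨_, ⟨l, rfl⟩, h⟩ := Metric.mem_closure_iff.1
      (TopologicalSpace.denseRange_denseSeq R ⟨u w, hu w⟩) (ε / 2) (half_pos hε)
    exact ⟨l, h⟩
  choose v hv using hv
  obtain ⟨y, hy, h⟩ := hφ ⟨s, n, k, v, j⟩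
  refine ⟨y, hy, fun z => ?_⟩
  refine (dist_triangle _ (target n v (cantorRestrict n z)) _).trans_lt ?_
  rw [← add_halves ε]
  refine add_lt_add ((h z).trans hj) ?_
  rw [dist_comm]
  exact hv _

end Generic

/-! ### Separating points by at most continuum many characters. -/

section Separation

universe u

/-- The characters of an abelian group separate points. -/
theorem exists_character_ne_zero {A : Type*} [AddCommGroup A] {a : A} (ha : a ≠ 0) :
    ∃ χ : A →+ UnitAddCircle, χ a ≠ 0 := by
  have ho : addOrderOf (a : A ⧸ (⊥ : AddSubgroup A)) ≠ 1 := by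
    rwa [Ne, AddMonoid.addOrderOf_eq_one_iff, QuotientAddGroup.eq_zero_iff,
      AddSubgroup.mem_bot]
  have hz : addOrderOf (a : A ⧸ (⊥ : AddSubgroup A)) • a = 0 := by
    rw [← AddSubgroup.mem_bot, ← QuotientAddGroup.eq_zero_iff, QuotientAddGroup.mk_nsmul]
    exact addOrderOf_nsmul_eq_zero _
  obtain ⟨v, hv, hov⟩ : ∃ v : UnitAddCircle, v ≠ 0 ∧
      addOrderOf (a : A ⧸ (⊥ : AddSubgroup A)) • v = 0 := by
    generalize addOrderOf (a : A ⧸ (⊥ : AddSubgroup A)) = o at ho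
    have key (n : ℕ) (hn : 0 < n) (hn1 : n ≠ 1) : ((1 / n : ℝ) : UnitAddCircle) ≠ 0 := by
      rwa [Ne, ← AddMonoid.addOrderOf_eq_one_iff, AddCircle.addOrderOf_period_div hn]
    rcases Nat.eq_zero_or_pos o with rfl | h
    · exact ⟨_, key 2 two_pos (by norm_num), zero_smul _ _⟩
    · refine ⟨_, key o h ho, ?_⟩
      have h0 := addOrderOf_nsmul_eq_zero ((1 / o : ℝ) : UnitAddCircle)
      rwa [AddCircle.addOrderOf_period_div h] at h0
  obtain ⟨χ, -, h⟩ := exists_extension_apply_eq (⊥ : AddSubgroup A)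
    (0 : (⊥ : AddSubgroup A) →+ UnitAddCircle) a v 0 hz.symm (by rw [hov, map_zero])
  exact ⟨χ, h ▸ hv⟩

/-- The points of a vector space of cardinality at most `2 ^ 𝔠` are separated by a family of
linear functionals of cardinality at most `𝔠`. -/
theorem exists_separating_functionals {K : Type*} [Field K] {V : Type*} [AddCommGroup V]
    [Module K V] (hV : #V ≤ 2 ^ 𝔠) :
    ∃ φ : Finset ℝ × Finset ℝ → V →ₗ[K] K, ∀ v, v ≠ 0 → ∃ j, φ j v ≠ 0 := by
  classical
  let b := Module.Basis.ofVectorSpace K V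
  obtain ⟨⟨g, hg⟩⟩ : Nonempty (V ↪ Set ℝ) := by
    rw [← Cardinal.lift_mk_le']
    simpa [Cardinal.mk_real] using hV
  -- Basis vectors are labelled by distinct subsets of `ℝ`. The functional for `(F, A)` detects
  -- labels with trace `A` on `F`; a suitable `F` isolates one basis vector in the support of `v`.
  refine ⟨fun j => b.constr K fun i => if j.1.filter (· ∈ g i) = j.2 then 1 else 0,
    fun v hv => ?_⟩
  obtain ⟨i₀, hi₀⟩ := Finsupp.support_nonempty_iff.2 (b.repr.map_ne_zero_iff.2 hv)
  have hsep (i : Module.Basis.ofVectorSpaceIndex K V) :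
      ∃ x : ℝ, i ≠ i₀ → ¬ (x ∈ g i ↔ x ∈ g i₀) := by
    by_contra! h
    exact (h 0).1 (Subtype.ext (hg (Set.ext fun x => (h x).2)))
  choose x hx using hsep
  let F := (b.repr v).support.image x
  refine ⟨(F, F.filter (· ∈ g i₀)), ?_⟩
  rw [Module.Basis.constr_apply, Finsupp.sum, Finset.sum_eq_single i₀]
  · simpa using hi₀
  · intro i hi hne
    rw [if_neg, smul_zero]
    intro h
    have hxF : x i ∈ F := Finset.mem_image_of_mem x hi
    refine hx i hne ?_
    have := Finset.ext_iff.1 h (x i)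
    simpa [hxF] using this
  · exact fun h => absurd hi₀ h

/-- A nonempty family of cardinality at most `𝔠` can be indexed by the real numbers. -/
theorem exists_surjective_of_mk_le_continuum {ι : Type*} [Nonempty ι] (h : #ι ≤ 𝔠) :
    ∃ f : ℝ → ι, Function.Surjective f := by
  obtain ⟨⟨g, hg⟩⟩ : Nonempty (ι ↪ ℝ) := by
    rw [← Cardinal.lift_mk_le']
    simpa [Cardinal.mk_real] using h
  exact ⟨Function.invFun g, Function.invFun_surjective hg⟩

theorem exists_separating_characters_of_module (K : Type) [Field K] [Countable K] {V : Type*}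
    [AddCommGroup V] [Module K V] (hV : #V ≤ 2 ^ 𝔠) :
    ∃ ψ : ℝ → V →+ UnitAddCircle, ∀ v, v ≠ 0 → ∃ r, ψ r v ≠ 0 := by
  obtain ⟨φ, hφ⟩ := exists_separating_functionals (K := K) hV
  have hχ (a : K) : ∃ χ : K →+ UnitAddCircle, a ≠ 0 → χ a ≠ 0 := by
    by_cases ha : a = 0
    · exact ⟨0, fun h => absurd ha h⟩
    · obtain ⟨χ, h⟩ := exists_character_ne_zero ha
      exact ⟨χ, fun _ => h⟩
  choose χ hχ using hχ
  obtain ⟨f, hf⟩ := exists_surjective_of_mk_le_continuum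
    (ι := (Finset ℝ × Finset ℝ) × K) (by
      simp only [Cardinal.mk_prod, Cardinal.lift_id, Cardinal.mk_finset_of_infinite,
        Cardinal.mk_real, Cardinal.continuum_mul_self]
      exact (mul_le_mul_right (Cardinal.mk_le_aleph0.trans Cardinal.aleph0_le_continuum) _).trans
        Cardinal.continuum_mul_self.le)
  refine ⟨fun r => (χ (f r).2).comp (φ (f r).1).toAddMonoidHom, fun v hv => ?_⟩
  obtain ⟨j, hj⟩ := hφ v hv
  obtain ⟨r, hr⟩ := hf (j, φ j v)
  refine ⟨r, ?_⟩
  simp only [hr]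
  exact hχ _ hj

/-- The points of an abelian group of cardinality at most `2 ^ 𝔠` are separated by a family of
characters of cardinality at most `𝔠`. -/
theorem exists_separating_characters {C : Type u} [AddCommGroup C] (hC : #C ≤ 2 ^ 𝔠) :
    ∃ ψ : ℝ → C →+ UnitAddCircle, ∀ x, x ≠ 0 → ∃ r, ψ r x ≠ 0 := by
  have hprime (p : ℕ) : ∃ ψ : ℝ → C →+ UnitAddCircle,
      p.Prime → ∀ x, p • x = 0 → x ≠ 0 → ∃ r, ψ r x ≠ 0 := by
    by_cases hp : p.Prime
    · have : Fact p.Prime := ⟨hp⟩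
      let : Module (ZMod p) (torsionKer C p) :=
        AddCommGroup.zmodModule fun x => Subtype.ext x.2
      obtain ⟨ψ, hψ⟩ := exists_separating_characters_of_module (ZMod p)
        (V := torsionKer C p) ((Cardinal.mk_subtype_le _).trans hC)
      choose ψ' hψ' using fun r => exists_comp_eq_of_ker_le (torsionKer C p).subtype (ψ r)
        (by simp)
      refine ⟨ψ', fun _ x hx hx0 => ?_⟩
      obtain ⟨r, hr⟩ := hψ ⟨x, hx⟩ fun h => hx0 (congrArg Subtype.val h)
      refine ⟨r, ?_⟩
      rw [← hψ'] at hr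
      exact hr
    · exact ⟨0, fun h => absurd h hp⟩
  choose ψ hψ using hprime
  -- Only torsion dies in the divisible hull, so `ψ₀` detects elements of infinite order; a nonzero
  -- torsion element has a multiple of prime order, detected by `ψ p`.
  obtain ⟨ψ₀, hψ₀⟩ := exists_separating_characters_of_module ℚ (V := DivisibleHull C) (by
    have hs : Function.Surjective fun c : C × ℕ+ => DivisibleHull.mk c.1 c.2 := by
      intro x
      induction x with
      | mk a b => exact ⟨(a, b), rfl⟩
    refine (Cardinal.mk_le_of_surjective hs).trans ?_
    have h𝔠 : 𝔠 ≤ (2 ^ 𝔠 : Cardinal.{u}) := (Cardinal.cantor 𝔠).le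
    rw [Cardinal.mk_prod, Cardinal.lift_uzero]
    refine (mul_le_mul' hC (?_ : _ ≤ (2 ^ 𝔠 : Cardinal.{u}))).trans
      (Cardinal.mul_eq_self (Cardinal.aleph0_le_continuum.trans h𝔠)).le
    rw [Cardinal.lift_le_aleph0.2 Cardinal.mk_le_aleph0 |>.antisymm (by simp)]
    exact Cardinal.aleph0_le_continuum.trans h𝔠)
  obtain ⟨f, hf⟩ := exists_surjective_of_mk_le_continuum (ι := Option ℕ × ℝ) (by
    simp [Cardinal.mk_prod, Cardinal.mk_real])
  refine ⟨fun r => match f r with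
    | (none, s) => (ψ₀ s).comp (DivisibleHull.coeAddMonoidHom C)
    | (some p, s) => ψ p s, fun x hx => ?_⟩
  by_cases hfin : IsOfFinAddOrder x
  · obtain ⟨p, hp, k, hk⟩ := Nat.exists_prime_and_dvd
      (mt AddMonoid.addOrderOf_eq_one_iff.1 hx)
    have hk0 : k • x ≠ 0 := by
      intro h
      have hpos := hfin.addOrderOf_pos
      have := Nat.le_of_dvd (Nat.pos_of_ne_zero (by rintro rfl; simp [hk] at hpos))
        (addOrderOf_dvd_iff_nsmul_eq_zero.2 h)
      nlinarith [hp.two_le]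
    obtain ⟨s, hs⟩ := hψ p hp (k • x) (by
      rw [← mul_nsmul', ← hk, addOrderOf_nsmul_eq_zero]) hk0
    obtain ⟨r, hr⟩ := hf (some p, s)
    refine ⟨r, fun h => hs ?_⟩
    simp only [hr] at h
    rw [map_nsmul, h, smul_zero]
  · obtain ⟨s, hs⟩ := hψ₀ (DivisibleHull.coeAddMonoidHom C x) (by
      intro h
      obtain ⟨u, hu⟩ := DivisibleHull.mk_eq_mk.1 (h.trans (DivisibleHull.mk_zero 1).symm)
      refine hfin (isOfFinAddOrder_iff_nsmul_eq_zero.2 ⟨u, u.pos, ?_⟩)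
      simpa using hu)
    obtain ⟨r, hr⟩ := hf (none, s)
    refine ⟨r, fun h => hs ?_⟩
    simp only [hr] at h
    exact h

end Separation

/-! ### The injective homomorphism to a power of the circle. -/

section Embedding

universe u

/-- A subgroup generated by a countable set maps injectively under a homomorphism of the whole group
to a countable group. -/
theorem exists_countable_hom_injOn {G : Type u} [AddCommGroup G] {X : Set G} (hX : X.Countable) :
    ∃ (E : Type u) (_ : AddCommGroup E) (_ : Countable E) (f : G →+ E) (D : AddSubgroup G),
      X ⊆ D ∧ Set.InjOn f D := by
  have : Countable X := hX
  let P : (X →₀ ℤ) →+ G := (Finsupp.linearCombination ℤ (Subtype.val : X → G)).toAddMonoidHom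
  let i : (X →₀ ℤ) →+ (X →₀ ℚ) := Finsupp.mapRange.addMonoidHom (Int.castAddHom ℚ)
  have hi : Function.Injective i :=
    Finsupp.mapRange_injective _ (map_zero _) Int.cast_injective
  let : DivisibleBy (X →₀ ℚ) ℤ :=
    ⟨fun x n => (n : ℚ)⁻¹ • x, fun x => by simp, fun {n} x hn => by
      rw [← Int.cast_smul_eq_zsmul ℚ, smul_inv_smul₀ (Int.cast_ne_zero.2 hn)]⟩
  -- The subgroup generated by `X` sits in the countable divisible group `ℚ^(X) / N`; divisibility
  -- extends this embedding to `G`.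
  let N := P.ker.map i
  let : DivisibleBy ((X →₀ ℚ) ⧸ N) ℤ :=
    (QuotientAddGroup.mk'_surjective N).divisibleBy _ fun a n =>
      map_zsmul (QuotientAddGroup.mk' N) n a
  obtain ⟨f, hf⟩ := exists_comp_eq_of_ker_le P ((QuotientAddGroup.mk' N).comp i)
    (fun a ha => (QuotientAddGroup.eq_zero_iff _).2 ⟨a, ha, rfl⟩)
  refine ⟨(X →₀ ℚ) ⧸ N, inferInstance, Quotient.countable, f, P.range, fun x hx => ?_, ?_⟩
  · exact ⟨Finsupp.single ⟨x, hx⟩ 1, by simp [P]⟩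
  · rintro _ ⟨a, rfl⟩ _ ⟨b, rfl⟩ hab
    rw [← sub_eq_zero, ← map_sub, ← map_sub, hf] at hab
    obtain ⟨c, hc, hca⟩ := (QuotientAddGroup.eq_zero_iff _).1 hab
    rw [hi hca] at hc
    rwa [← sub_eq_zero, ← map_sub]

theorem exists_cantorRestrict_injOn (S : Finset (ℕ → Bool)) :
    ∃ n, Set.InjOn (cantorRestrict n) S := by
  have hN (z z' : ℕ → Bool) : ∃ N, z ≠ z' → z N ≠ z' N := by
    by_cases h : z = z'
    · exact ⟨0, fun h' => absurd h h'⟩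
    · obtain ⟨N, hN⟩ := Function.ne_iff.1 h
      exact ⟨N, fun _ => hN⟩
  choose N hN using hN
  refine ⟨(S ×ˢ S).sup (fun p => N p.1 p.2) + 1, fun z hz z' hz' h => ?_⟩
  by_contra hne
  exact hN z z' hne (congrFun h ⟨N z z', Nat.lt_succ_of_le
    (Finset.le_sup (f := fun p : (ℕ → Bool) × (ℕ → Bool) => N p.1 p.2) (b := (z, z'))
      (Finset.mem_product.2 ⟨hz, hz'⟩))⟩)

/-- The Cantor space maps onto any set of cardinality at most `𝔠` with one further point added, with
a dense fibre over the added point. -/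
theorem exists_dense_fibre {ι : Type*} [Nonempty ι] (hι : #ι ≤ 𝔠) :
    ∃ κ : (ℕ → Bool) → Option ι, Dense {z | κ z = none} ∧ ∀ i, ∃ z, κ z = some i := by
  classical
  obtain ⟨f, hf⟩ := exists_surjective_of_mk_le_continuum hι
  obtain ⟨J, hJc, hJd⟩ := TopologicalSpace.exists_countable_dense (ℕ → Bool)
  have hZ : #(ℕ → Bool) = 𝔠 := by simp
  have hJ : #(Jᶜ : Set (ℕ → Bool)) = #ℝ := by
    rw [Cardinal.mk_compl_of_infinite J (hJc.le_aleph0.trans_lt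
      (hZ ▸ Cardinal.aleph0_lt_continuum)), hZ, Cardinal.mk_real]
  obtain ⟨e⟩ := Cardinal.eq.1 hJ
  refine ⟨fun z => if h : z ∈ Jᶜ then some (f (e ⟨z, h⟩)) else none, ?_, fun i => ?_⟩
  · refine hJd.mono fun z hz => ?_
    simp [hz]
  · obtain ⟨r, rfl⟩ := hf i
    exact ⟨e.symm r, (dif_pos (e.symm r).2).trans (by simp)⟩

/-- A countable Zariski dense set is dense for the initial topology of some injective homomorphism
to a power of the circle. -/
theorem exists_injective_hom_dense {G : Type u} [AddCommGroup G] (hG : #G ≤ 2 ^ 𝔠) {X : Set G}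
    (hXc : X.Countable) (hX : zariskiClosure X = Set.univ) :
    ∃ π : G →+ ((ℕ → Bool) → UnitAddCircle), Function.Injective π ∧
      ∀ (g : G) (S : Finset (ℕ → Bool)), ∀ ε > 0, ∃ x ∈ X, ∀ z ∈ S,
        dist (π x z) (π g z) < ε := by
  classical
  obtain ⟨m, hm⟩ := exists_finiteIndex_torsionKer_iff G
  have hspread := isSpread_of_zariskiClosure_eq_univ hX hm
  obtain ⟨E, _, _, f, D, hXD, hfD⟩ := exists_countable_hom_injOn hXc
  have : Countable X := hXc
  obtain ⟨ψ, hψ⟩ := exists_separating_characters (C := G ⧸ D)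
    ((Cardinal.mk_le_of_surjective (QuotientAddGroup.mk_surjective (s := D))).trans hG)
  have hχ (e : E) : ∃ χ : E →+ UnitAddCircle, e ≠ 0 → χ e ≠ 0 := by
    by_cases he : e = 0
    · exact ⟨0, fun h => absurd he h⟩
    · obtain ⟨χ, h⟩ := exists_character_ne_zero he
      exact ⟨χ, fun _ => h⟩
  choose χ hχ using hχ
  let ρ : Option E → E →+ UnitAddCircle := fun k => k.elim 0 χ
  let σ : Option (E ⊕ ℝ) → G →+ UnitAddCircle := fun w =>
    w.elim 0 (Sum.elim (fun e => (χ e).comp f) fun r => (ψ r).comp (QuotientAddGroup.mk' D))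
  let trace : Option (E ⊕ ℝ) → Option E := fun w => w.elim none (Sum.elim some fun _ => none)
  have hσ (w : Option (E ⊕ ℝ)) (y : G) (hy : y ∈ D) : σ w y = ρ (trace w) (f y) := by
    rcases w with _ | e | r
    · rfl
    · rfl
    · change ψ r (QuotientAddGroup.mk' D y) = 0
      rw [QuotientAddGroup.mk'_apply, (QuotientAddGroup.eq_zero_iff y).2 hy, map_zero]
  have hYD (x : X) : {y : G | m • y = 0 ∧ (x : G) + y ∈ X} ⊆ D := by
    rintro y ⟨-, hy⟩
    exact (AddSubgroup.add_mem_cancel_left D (hXD x.2)).1 (hXD hy)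
  obtain ⟨φ, hφ⟩ := exists_generic_family (m := m)
    (fun x : X => f '' {y | m • y = 0 ∧ (x : G) + y ∈ X})
    (fun x => (hspread x).image f D (hYD x) hfD)
    (by
      rintro x _ ⟨y, hy, rfl⟩
      rw [← map_nsmul, hy.1, map_zero]) ρ
  obtain ⟨κ, hκd, hκ⟩ := exists_dense_fibre (ι := E ⊕ ℝ) (by
    rw [Cardinal.mk_sum, Cardinal.mk_real, Cardinal.lift_continuum]
    refine Cardinal.add_le_of_le Cardinal.aleph0_le_continuum ?_ le_rfl
    exact (Cardinal.lift_le_aleph0.2 Cardinal.mk_le_aleph0).trans Cardinal.aleph0_le_continuum)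
  refine ⟨AddMonoidHom.mk' (fun g z => φ (f g) z + σ (κ z) g) (fun g g' => by
    funext z
    simp only [map_add, ContinuousMap.add_apply, Pi.add_apply]
    abel), ?_, fun g S ε hε => ?_⟩
  · rw [injective_iff_map_eq_zero]
    intro g hg
    replace hg (z : ℕ → Bool) : φ (f g) z + σ (κ z) g = 0 := congrFun hg z
    -- The shift vanishes on the dense fibre over `none`, so continuity forces `φ (f g) = 0` and
    -- every shift must then kill `g`.
    have hφ0 : φ (f g) = 0 := by
      refine ContinuousMap.coe_injective (Continuous.ext_on hκd (φ (f g)).continuous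
        continuous_zero fun z hz => ?_)
      have h := hg z
      rw [Set.mem_ofPred_eq] at hz
      rw [hz] at h
      simpa [σ] using h
    replace hg (w : E ⊕ ℝ) : σ (some w) g = 0 := by
      obtain ⟨z, hz⟩ := hκ w
      simpa [hφ0, hz] using hg z
    have hf0 : f g = 0 := by
      by_contra h
      exact hχ _ h (hg (Sum.inl (f g)))
    have hgD : g ∈ D := by
      by_contra h
      obtain ⟨r, hr⟩ := hψ (g : G ⧸ D) (mt (QuotientAddGroup.eq_zero_iff g).1 h)
      exact hr (hg (Sum.inr r))
    exact hfD hgD D.zero_mem (hf0.trans (map_zero f).symm)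
  -- Moving to a base point `g + y₀` in `X` leaves countably many spread sets to treat; the added
  -- `y` must then approximately cancel `π y₀`, whose values are killed by `m`.
  · obtain ⟨y₀, ⟨hy₀, hgy₀⟩, -⟩ := hspread g ∅ Set.finite_empty (by simp)
    obtain ⟨n, hn⟩ := exists_cantorRestrict_injOn S
    let r : (Fin n → Bool) → ℕ → Bool := fun w =>
      if h : ∃ z ∈ S, cantorRestrict n z = w then h.choose else fun _ => false
    have hr (z) (hz : z ∈ S) : r (cantorRestrict n z) = z := by
      have h : ∃ z' ∈ S, cantorRestrict n z' = cantorRestrict n z := ⟨z, hz, rfl⟩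
      simp only [r, dif_pos h]
      exact hn h.choose_spec.1 hz h.choose_spec.2
    obtain ⟨_, ⟨y, hy, rfl⟩, h⟩ := hφ ⟨g + y₀, hgy₀⟩ n (fun w => trace (κ (r w)))
      (fun w => -(φ (f y₀) (r w) + σ (κ (r w)) y₀)) (fun w => by
        rw [smul_neg, smul_add, ← ContinuousMap.nsmul_apply, ← map_nsmul, ← map_nsmul,
          ← map_nsmul, hy₀]
        simp) ε hε
    refine ⟨g + y₀ + y, hy.2, fun z hz => ?_⟩
    have hz' := h z
    rw [hr z hz, ← hσ _ _ (hYD ⟨g + y₀, hgy₀⟩ hy)] at hz'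
    rw [dist_eq_norm] at hz' ⊢
    convert hz' using 2
    simp only [AddMonoidHom.mk'_apply, map_add, Pi.add_apply]
    abel

end Embedding

/-! ### Necessity of the conditions and the precompact topology. -/

section PotentialDensity

universe u

/-- A Hausdorff space with a countable dense subset has cardinality at most `2 ^ 𝔠`. -/
theorem mk_le_two_power_continuum_of_dense {G : Type u} [TopologicalSpace G] [T2Space G]
    {X : Set G} (hXc : X.Countable) (hX : Dense X) : #G ≤ 2 ^ 𝔠 := by
  -- A point is determined by the subsets of `X` whose closure contains it: for disjoint
  -- neighbourhoods `U`, `V` of two points, `X ∩ U` tells them apart.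
  have hinj : Function.Injective fun x : G => {A : Set X | x ∈ closure (Subtype.val '' A)} := by
    intro x y hxy
    by_contra hne
    obtain ⟨U, V, hU, hV, hxU, hyV, hUV⟩ := t2_separation hne
    have himg : Subtype.val '' (Subtype.val ⁻¹' U : Set X) = X ∩ U := by
      rw [Subtype.image_preimage_coe]
    have hx : x ∈ closure (Subtype.val '' (Subtype.val ⁻¹' U : Set X)) := by
      rw [himg, Set.inter_comm]
      exact hX.open_subset_closure_inter hU hxU
    have hy : y ∈ closure (Subtype.val '' (Subtype.val ⁻¹' U : Set X)) :=
      (Set.ext_iff.1 hxy (Subtype.val ⁻¹' U)).1 hx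
    rw [himg] at hy
    obtain ⟨w, hwV, -, hwU⟩ := mem_closure_iff.1 hy V hV hyV
    exact Set.disjoint_left.1 hUV hwU hwV
  refine (Cardinal.mk_le_of_injective hinj).trans ?_
  rw [Cardinal.mk_set, Cardinal.mk_set, ← Cardinal.two_power_aleph0]
  exact Cardinal.power_le_power_left two_ne_zero
    (Cardinal.power_le_power_left two_ne_zero hXc.le_aleph0)

/-- Algebraic sets are closed in every Hausdorff group topology. -/
theorem IsAlgebraicSet.isClosed {G : Type*} [AddCommGroup G] [TopologicalSpace G]
    [IsTopologicalAddGroup G] [T2Space G] {S : Set G} (hS : IsAlgebraicSet S) : IsClosed S := by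
  obtain ⟨B, hB, rfl⟩ := hS
  refine isClosed_sInter fun F hF => ?_
  obtain ⟨A, hA, hAE, rfl⟩ := hB F hF
  rw [Set.sUnion_eq_biUnion]
  refine hA.isClosed_biUnion fun S hS => ?_
  obtain ⟨g, n, rfl⟩ := hAE S hS
  refine (Homeomorph.addLeft g).isClosedMap _ ?_
  exact isClosed_eq (continuous_nsmul n) continuous_const

/-- A dense set in a Hausdorff group topology is Zariski dense. -/
theorem zariskiClosure_eq_univ_of_dense {G : Type*} [AddCommGroup G] [TopologicalSpace G]
    [IsTopologicalAddGroup G] [T2Space G] {X : Set G} (hX : Dense X) :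
    zariskiClosure X = Set.univ := by
  have halg : IsAlgebraicSet (zariskiClosure X) :=
    isClosed_zariskiTopology_iff.1 (@isClosed_closure G (zariskiTopology G) X)
  exact (hX.mono (@subset_closure G (zariskiTopology G) X)).closure_eq ▸
    halg.isClosed.closure_eq.symm

/-- The completion of a totally bounded space is compact. -/
theorem compactSpace_completion_of_totallyBounded {α : Type*} [UniformSpace α]
    (h : TotallyBounded (Set.univ : Set α)) : CompactSpace (UniformSpace.Completion α) := by
  rw [← isCompact_univ_iff, isCompact_iff_totallyBounded_isComplete]
  refine ⟨?_, isClosed_univ.isComplete⟩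
  have := (h.image (UniformSpace.Completion.uniformContinuous_coe α)).closure
  rwa [Set.image_univ, UniformSpace.Completion.denseRange_coe.closure_range] at this

/-- The initial topology of a homomorphism to a compact group is precompact. -/
theorem isPrecompactGroup_of_isInducing {G H : Type*} [AddCommGroup G] [t : TopologicalSpace G]
    [IsTopologicalAddGroup G] [AddCommGroup H] [UniformSpace H] [IsUniformAddGroup H]
    [CompactSpace H] {π : G →+ H} (hπ : Topology.IsInducing π) : IsPrecompactGroup G := by
  obtain rfl := hπ.eq_induced
  let u : UniformSpace G := UniformSpace.comap π inferInstance
  have hu : IsUniformAddGroup G := IsUniformAddGroup.comap π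
  have heq : IsTopologicalAddGroup.rightUniformSpace G = u :=
    IsUniformAddGroup.rightUniformSpace_eq
  unfold IsPrecompactGroup
  rw [heq]
  refine compactSpace_completion_of_totallyBounded ?_
  have := totallyBounded_preimage (f := π) ⟨rfl⟩ (isCompact_univ (X := H)).totallyBounded
  rwa [Set.preimage_univ] at this

/-- A countable Zariski dense set is dense in a precompact Hausdorff group topology. -/
theorem exists_precompact_topology_dense {G : Type u} [AddCommGroup G] (hG : #G ≤ 2 ^ 𝔠)
    {X : Set G} (hXc : X.Countable) (hX : zariskiClosure X = Set.univ) :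
    ∃ (_ : TopologicalSpace G) (_ : IsTopologicalAddGroup G),
      T2Space G ∧ IsPrecompactGroup G ∧ Dense X := by
  obtain ⟨π, hπ, hd⟩ := exists_injective_hom_dense hG hXc hX
  let t : TopologicalSpace G := TopologicalSpace.induced π inferInstance
  have hind : Topology.IsInducing π := ⟨rfl⟩
  have hgrp : IsTopologicalAddGroup G := topologicalAddGroup_induced π
  refine ⟨t, hgrp, T2Space.of_injective_continuous hπ hind.continuous,
    isPrecompactGroup_of_isInducing hind, fun g => ?_⟩
  rw [hind.closure_eq_preimage_closure_image, Set.mem_preimage, mem_closure_iff]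
  intro W hW hgW
  obtain ⟨F, B, hB, hBW⟩ := isOpen_pi_iff.1 hW _ hgW
  have hev : ∀ᶠ δ in nhdsWithin (0 : ℝ) (Set.Ioi 0),
      ∀ z ∈ F, Metric.ball (π g z) δ ⊆ B z := by
    rw [Filter.eventually_all_finset]
    intro z hz
    obtain ⟨δ, hδ, h⟩ := Metric.isOpen_iff.1 (hB z hz).1 _ (hB z hz).2
    filter_upwards [Ioo_mem_nhdsGT hδ] with δ' hδ'
    exact (Metric.ball_subset_ball hδ'.2.le).trans h
  obtain ⟨δ, hδF, hδ⟩ := (hev.and self_mem_nhdsWithin).exists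
  obtain ⟨x, hx, hxF⟩ := hd g F δ hδ
  exact ⟨π x, hBW fun z hz => hδF z hz (hxF z hz), x, hx, rfl⟩

end PotentialDensity

theorem mainTheorem8 {G : Type*} [AddCommGroup G] (X : Set G)
    (hXc : X.Countable) (hXi : X.Infinite) :
    List.TFAE [
      PotentiallyDense X,
      ∃ (_ : TopologicalSpace G) (_ : IsTopologicalAddGroup G),
        T2Space G ∧ IsPrecompactGroup G ∧ Dense X,
      Cardinal.mk G ≤ 2 ^ 𝔠 ∧ zariskiClosure X = Set.univ] := by
  tfae_have 2 → 1
  | ⟨t, hG, hT2, _, hX⟩ => ⟨t, hG, hT2, hX⟩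
  tfae_have 1 → 3
  | ⟨_, _, _, hX⟩ =>
    ⟨mk_le_two_power_continuum_of_dense hXc hX, zariskiClosure_eq_univ_of_dense hX⟩
  tfae_have 3 → 2
  | ⟨hG, hX⟩ => exists_precompact_topology_dense hG hXc hX
  tfae_finish
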